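/- Call a group $G$ capable if $G\cong H/Z(H)$ for some group $H$. Write $[x,y]=x^{-1}y^{-1}xy$, $[x,y,z]=[[x,y],z]$, and let $K_1=K$, $K_{k+1}=[K_k,K]$ be the lower central series of a group $K$. Let $p$ be an odd prime and $G$ a noncyclic group of exponent $p$ and nilpotency class at most $2$. Let $g_1,\dots,g_n\in G$ project onto an $\mathbb{F}_p$-basis of $G^{\mathrm{ab}}$. Let $P$ be the free product of $n$ cyclic groups of order $p$ with generators $x_1,\dots,x_n$, let $F=P/P_4$ (the $3$-nilpotent product), let $C=\langle [x_j,x_i] : 1\le i<j\le n\rangle\le F$, and let $\psi\colon F\to G$ be the homomorphism with $\psi(x_i)=g_i$. Let $U$ be an $\mathbb{F}_p$-vector space with basis $u_1,\dots,u_n$, let $V=\Lambda^2U$ and $W=(V\otimes U)/J$, where $J$ is spanned by all $(a\wedge b)\otimes c+(b\wedge c)\otimes a+(c\wedge a)\otimes b$ with $a,b,c\in U$. For $u\in U$ let $\varphi_u\colon V\to W$ send $v$ to the class of $v\otimes u$. For subspaces $X\le V$ and $Y\le W$ put $X^*=\operatorname{span}\bigl(\varphi_u(X): u\in U\bigr)$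 and $Y^*=\bigcap_{u\in U}\varphi_u^{-1}(Y)$, and call $X$ closed if $X=X^{**}$. Then: (1) there is a unique isomorphism $V\oplus W\cong F_2$ sending $u_j\wedge u_i$ to $[x_j,x_i]$ and $\varphi_{u_k}(u_j\wedge u_i)$ to $[x_j,x_i,x_k]$ for all $i,j,k$; (2) there is a unique subgroup $X$ of $C$ such that $\ker\psi=X\oplus F_3$; (3) viewing $X$ as a subspace of $V$ through the identification in (1), $G$ is capable if and only if $X$ is closed. -/

import Mathlib

open scoped TensorProduct

namespace CapableGroups

/-! ### Groups -/

/-- A group `G` is capable if it is isomorphic to `H / Z(H)` for some group `H`.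
(Letting `H` range over the universe of `G` is no restriction: in any witness, the subgroup generated
by representatives of the cosets of the centre is again a witness, and it is small.) -/
def IsCapable.{u} (G : Type u) [Group G] : Prop :=
  ∃ (H : Type u) (_ : Group H), Nonempty (G ≃* H ⧸ Subgroup.center H)

/-- The `k`-th term `G_k` of the lower central series, for `k ≥ 1`: `G_1 = G` and
`G_{k+1} = [G_k, G]`. -/
abbrev lowerCentral (k : ℕ) (G : Type*) [Group G] : Subgroup G :=
  (⊤ : Subgroup G).lowerCentralSeries (k - 1)

/-- The commutator `[x, y] = x⁻¹ y⁻¹ x y`. -/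
def comm {G : Type*} [Group G] (x y : G) : G := x⁻¹ * y⁻¹ * x * y

/-- The `k`-nilpotent product of a family of groups: the free product modulo the `(k+1)`-st term of
its lower central series. -/
abbrev NilpotentProduct {ι : Type*} (k : ℕ) (A : ι → Type*) [∀ i, Group (A i)] : Type _ :=
  Monoid.CoprodI A ⧸ lowerCentral (k + 1) (Monoid.CoprodI A)

/-- The universal property of the `k`-nilpotent product: homomorphisms from the factors to a group
of class at most `k` extend to the product. -/
def NilpotentProduct.lift {ι : Type*} {k : ℕ} {A : ι → Type*} [∀ i, Group (A i)]
    {G : Type*} [Group G] (hG : lowerCentral (k + 1) G = ⊥) (f : ∀ i, A i →* G) :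
    NilpotentProduct k A →* G :=
  QuotientGroup.lift _ (Monoid.CoprodI.lift f) (by
    rw [← Subgroup.map_eq_bot_iff, Subgroup.map_lowerCentralSeries, eq_bot_iff, ← hG]
    exact Subgroup.lowerCentralSeries_mono _ le_top)

/-- The `3`-nilpotent product `F` of `n` cyclic groups of order `p`. -/
abbrev F (p n : ℕ) : Type :=
  NilpotentProduct 3 (fun _ : Fin n => Multiplicative (ZMod p))

/-- The generator `x_i` of the `i`-th cyclic factor of `F`. -/
def gen (p : ℕ) {n : ℕ} (i : Fin n) : F p n :=
  QuotientGroup.mk (Monoid.CoprodI.of (M := fun _ : Fin n => Multiplicative (ZMod p))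
    (i := i) (Multiplicative.ofAdd 1))

/-- The subgroup `C` of `F` generated by the commutators `[x_j, x_i]`, `i < j`. -/
def C (p n : ℕ) : Subgroup (F p n) :=
  Subgroup.closure {c | ∃ i j : Fin n, i < j ∧ c = comm (gen p j) (gen p i)}

/-- The homomorphism from the cyclic group of order `p` that sends the generator to `g`. -/
def cyclicHom {p : ℕ} {G : Type*} [Group G] (g : G) (hg : g ^ p = 1) :
    Multiplicative (ZMod p) →* G :=
  AddMonoidHom.toMultiplicativeLeft
    (ZMod.lift p ⟨zmultiplesHom (Additive G) (Additive.ofMul g), by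
      simp [← ofMul_pow, hg]⟩)

/-- The homomorphism `ψ : F → G` with `x_i ↦ g_i`, for `G` of class at most two and exponent
`p`. -/
def psi {p n : ℕ} {G : Type*} [Group G] (hclass : lowerCentral 3 G = ⊥)
    (hexp : Monoid.exponent G = p) (g : Fin n → G) : F p n →* G :=
  NilpotentProduct.lift (k := 3)
    (eq_bot_iff.2 (((⊤ : Subgroup G).lowerCentralSeries_antitone (by decide : 2 ≤ 3)).trans
      hclass.le))
    (fun i => cyclicHom (g i) (hexp ▸ Monoid.pow_exponent_eq_one (g i)))

theorem psi_gen {p n : ℕ} {G : Type*} [Group G] (hclass : lowerCentral 3 G = ⊥)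
    (hexp : Monoid.exponent G = p) (g : Fin n → G) (i : Fin n) :
    psi hclass hexp g (gen p i) = g i := by
  have h : (1 : ZMod p) = ((1 : ℤ) : ZMod p) := by simp
  simp only [psi, NilpotentProduct.lift, gen, QuotientGroup.lift_mk, Monoid.CoprodI.lift_of,
    cyclicHom, AddMonoidHom.coe_toMultiplicativeLeft, Function.comp, toAdd_ofAdd]
  rw [h, ZMod.lift_coe]
  simp

/-- The abelianization of a group of exponent `p`, as a vector space over `𝔽_p`. -/
abbrev abelianizationModule {p : ℕ} {G : Type*} [Group G] (hexp : Monoid.exponent G = p) :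
    Module (ZMod p) (Additive (Abelianization G)) :=
  AddCommGroup.zmodModule (n := p) (fun x => by
    obtain ⟨y, hy⟩ := QuotientGroup.mk_surjective (Additive.toMul x)
    apply Additive.toMul.injective
    have h : (Abelianization.of y) ^ p = 1 := by
      rw [← map_pow, ← hexp, Monoid.pow_exponent_eq_one, map_one]
    rw [toMul_nsmul]
    change _ = (1 : Abelianization G)
    rw [← h]
    exact congrArg (· ^ p) hy.symm)

/-- The family `a` is a basis of the vector space `A`. -/
def IsBasis (K : Type*) {ι A : Type*} [Semiring K] [AddCommMonoid A] [Module K A] (a : ι → A) :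
    Prop :=
  ∃ b : Module.Basis ι K A, ∀ i, b i = a i

/-- The elements `g_1, …, g_n` of `G` project onto an `𝔽_p`-basis of the abelianization. -/
def ProjectsToBasis {p n : ℕ} {G : Type*} [Group G] (hexp : Monoid.exponent G = p)
    (g : Fin n → G) : Prop :=
  letI := abelianizationModule hexp
  IsBasis (ZMod p) (fun i => Additive.ofMul (Abelianization.of (g i)))

/-! ### The closure operator of a family of linear maps -/

section Star

variable {K V W ι : Type*} [Field K] [AddCommGroup V] [Module K V] [AddCommGroup W] [Module K W]

/-- `X^* = span (ℓ_i(X) | i ∈ I)` for a subspace `X` of `V`. -/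
def upStar (ℓ : ι → V →ₗ[K] W) (X : Submodule K V) : Submodule K W :=
  Submodule.span K (⋃ i, ℓ i '' X)

/-- `Y^* = ⋂ i, ℓ_i⁻¹(Y)` for a subspace `Y` of `W`. -/
def downStar (ℓ : ι → V →ₗ[K] W) (Y : Submodule K W) : Submodule K V :=
  ⨅ i, Y.comap (ℓ i)

/-- `X` is `{ℓ_i}`-closed: `X = X^{**}`. -/
def IsClosedFor (ℓ : ι → V →ₗ[K] W) (X : Submodule K V) : Prop :=
  X = downStar ℓ (upStar ℓ X)

end Star

/-! ### The spaces `V = U ∧ U` and `W = (V ⊗ U) / J` -/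

section UVW

variable (K : Type*) [Field K] (U : Type*) [AddCommGroup U] [Module K U]

/-- `V = U ∧ U`. -/
def V : Type _ := ⋀[K]^2 U

instance : AddCommGroup (V K U) := inferInstanceAs (AddCommGroup (⋀[K]^2 U))

instance : Module K (V K U) := inferInstanceAs (Module K (⋀[K]^2 U))

variable {U}

/-- The vector `a ∧ b` of `V`. -/
def wedge (a b : U) : V K U := exteriorPower.ιMulti K 2 ![a, b]

variable (U)

/-- The subspace `J` of `V ⊗ U` spanned by all
`(a ∧ b) ⊗ c + (b ∧ c) ⊗ a + (c ∧ a) ⊗ b`. -/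
def J : Submodule K (V K U ⊗[K] U) :=
  Submodule.span K
    {t | ∃ a b c : U, t = wedge K a b ⊗ₜ[K] c + wedge K b c ⊗ₜ[K] a + wedge K c a ⊗ₜ[K] b}

/-- `W = (V ⊗ U) / J`. -/
abbrev W : Type _ := (V K U ⊗[K] U) ⧸ J K U

variable {U}

/-- `φ_u : V → W`, where `φ_u(v)` is the image of `v ⊗ u` in `W`. -/
def phi (u : U) : V K U →ₗ[K] W K U :=
  (J K U).mkQ ∘ₗ (TensorProduct.mk K (V K U) U).flip u

end UVW

/-! ### The identification of `F_2` with `V ⊕ W` -/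

section Identification

variable {p n : ℕ} [Fact p.Prime] {U : Type*} [AddCommGroup U] [Module (ZMod p) U]

/-- An isomorphism `e : V ⊕ W ≃ F_2` is the identification relative to the basis `u_1, …, u_n` of
`U` if it sends `v_{ji} = u_j ∧ u_i` to `[x_j, x_i]` and `w_{jik} = φ_{u_k}(v_{ji})` to
`[x_j, x_i, x_k]`. -/
def IsIdentification (u : Module.Basis (Fin n) (ZMod p) U)
    (e : Multiplicative (V (ZMod p) U × W (ZMod p) U) ≃* lowerCentral 2 (F p n)) : Prop :=
  (∀ j i, (e (Multiplicative.ofAdd (wedge (ZMod p) (u j) (u i), 0)) : F p n)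
    = comm (gen p j) (gen p i)) ∧
  (∀ j i k, (e (Multiplicative.ofAdd (0, phi (ZMod p) (u k) (wedge (ZMod p) (u j) (u i)))) : F p n)
    = comm (comm (gen p j) (gen p i)) (gen p k))

/-- The subspace of `V` that corresponds to a subgroup `X` of `F` under the identification `e`. -/
def toSubspace (e : Multiplicative (V (ZMod p) U × W (ZMod p) U) ≃* lowerCentral 2 (F p n))
    (X : Subgroup (F p n)) : Submodule (ZMod p) (V (ZMod p) U) where
  carrier := {v | (e (Multiplicative.ofAdd (v, 0)) : F p n) ∈ X}
  add_mem' := by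
    intro a b ha hb
    have h : Multiplicative.ofAdd ((a + b, 0) : V (ZMod p) U × W (ZMod p) U)
        = Multiplicative.ofAdd (a, 0) * Multiplicative.ofAdd (b, 0) := by
      rw [← ofAdd_add, Prod.mk_add_mk, add_zero]
    simp only [Set.mem_ofPred_eq] at ha hb ⊢
    rw [h, map_mul]
    exact X.mul_mem ha hb
  zero_mem' := by
    have h : Multiplicative.ofAdd ((0, 0) : V (ZMod p) U × W (ZMod p) U) = 1 := rfl
    simp only [Set.mem_ofPred_eq]
    rw [h, map_one]
    exact X.one_mem
  smul_mem' := by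
    intro c a ha
    have h : Multiplicative.ofAdd ((c • a, 0) : V (ZMod p) U × W (ZMod p) U)
        = Multiplicative.ofAdd (a, 0) ^ c.val := by
      rw [← ofAdd_nsmul, ← Nat.cast_smul_eq_nsmul (ZMod p), ZMod.natCast_zmod_val, Prod.smul_mk,
        smul_zero]
    simp only [Set.mem_ofPred_eq] at ha ⊢
    rw [h, map_pow]
    exact X.pow_mem ha _

/-- `X` is a subgroup of `C` and `N = X ⊕ F_3` (as an internal direct sum; both summands lie in the
abelian group `F_2`). -/
structure IsRelationSubgroup (N X : Subgroup (F p n)) : Prop where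
  le_C : X ≤ C p n
  inf_eq : X ⊓ lowerCentral 3 (F p n) = ⊥
  sup_eq : X ⊔ lowerCentral 3 (F p n) = N

end Identification

end CapableGroups

/-!
In a group `K` of class at most three, commutation is bilinear enough, and satisfies the Jacobi
identity, so that for elements `x_i` whose `p`-th powers commute with every `x_j` there are
homomorphisms `α : V → K` and `β : W → K` with `α(u_j ∧ u_i) = [x_j, x_i]` and
`β(φ_{u_k}(v)) = [α(v), x_k]`. For `K = F`, representations by unitriangular `4 × 4` matrices supply
functionals dual to the spanning sets of `V` and `W`, so `α` is injective modulo `F_3` and `β` is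
injective; hence `(v, w) ↦ α(v) β(w)` is an isomorphism `V ⊕ W ≅ F_2`.

If `G = H / Z(H)`, then `H` has class at most three. For its pair `(α, β)` attached to lifts of the
`g_i`, a vector `v` is in `X` iff `α(v)` is central, iff `β` kills all `φ_u(v)`. Thus
`X = (ker β)^*`, and such spaces are closed because the two stars form a Galois connection.
Conversely, if `X = X^{**}`, then the centre of `F / β(X^*)` is `ker ψ / β(X^*)`, with
quotient `G`.
-/

namespace CapableGroups

open scoped commutatorElement

section Commutators

variable {K L : Type*} [Group K] [Group L]

theorem comm_eq_commutatorElement (x y : K) : comm x y = ⁅x⁻¹, y⁻¹⁆ := by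
  simp [comm, commutatorElement_def]

theorem map_comm (f : K →* L) (x y : K) : f (comm x y) = comm (f x) (f y) := by
  simp [comm]

theorem comm_inv (x y : K) : (comm x y)⁻¹ = comm y x := by
  simp [comm, mul_assoc]

@[simp] theorem comm_one_right (x : K) : comm x 1 = 1 := by simp [comm]

@[simp] theorem comm_one_left (x : K) : comm 1 x = 1 := by simp [comm]

theorem comm_eq_one_iff {x y : K} : comm x y = 1 ↔ Commute x y := by
  rw [comm_eq_commutatorElement, commutatorElement_eq_one_iff_commute, Commute.inv_inv_iff]

@[simp] theorem comm_self (x : K) : comm x x = 1 := comm_eq_one_iff.2 (Commute.refl x)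

theorem mul_mul_comm (x y : K) : y * x * comm x y = x * y := by
  simp [comm, mul_assoc]

theorem comm_mem_lowerCentral_two (x y : K) : comm x y ∈ lowerCentral 2 K := by
  rw [comm_eq_commutatorElement]
  exact Subgroup.commutator_mem_commutator (Subgroup.mem_top _) (Subgroup.mem_top _)

theorem comm_mem_lowerCentral_three {v : K} (hv : v ∈ lowerCentral 2 K) (x : K) :
    comm v x ∈ lowerCentral 3 K := by
  rw [comm_eq_commutatorElement]
  exact Subgroup.commutator_mem_commutator (inv_mem hv) (Subgroup.mem_top _)

theorem lowerCentral_two_le {S : Subgroup K} (h : ∀ x y, comm x y ∈ S) : lowerCentral 2 K ≤ S :=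
  Subgroup.commutator_le.2 fun x _ y _ => by
    simpa only [comm_eq_commutatorElement, inv_inv] using h x⁻¹ y⁻¹

theorem lowerCentral_three_le {S : Subgroup K}
    (h : ∀ v ∈ lowerCentral 2 K, ∀ x, comm v x ∈ S) : lowerCentral 3 K ≤ S :=
  Subgroup.commutator_le.2 fun v hv x _ => by
    simpa only [comm_eq_commutatorElement, inv_inv] using h v⁻¹ (inv_mem hv) x⁻¹

theorem lowerCentral_three_le_two : lowerCentral 3 K ≤ lowerCentral 2 K :=
  Subgroup.lowerCentralSeries_antitone _ one_le_two

theorem map_mem_lowerCentral (f : K →* L) {k : ℕ} {x : K} (hx : x ∈ lowerCentral k K) :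
    f x ∈ lowerCentral k L := by
  have h := Subgroup.mem_map_of_mem f hx
  rw [Subgroup.map_lowerCentralSeries] at h
  exact Subgroup.lowerCentralSeries_mono _ le_top h

end Commutators

section Generators

variable {K L ι : Type*} [Group K] [Group L] {x : ι → K}

theorem mem_center_iff_of_closure_sup_center
    (hx : Subgroup.closure (Set.range x) ⊔ Subgroup.center K = ⊤) {z : K} :
    z ∈ Subgroup.center K ↔ ∀ k, comm z (x k) = 1 := by
  simp only [comm_eq_one_iff]
  refine ⟨fun hz k => (Subgroup.mem_center_iff.1 hz (x k)).symm, fun h => ?_⟩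
  have hle : Subgroup.closure (Set.range x) ⊔ Subgroup.center K ≤ Subgroup.centralizer {z} := by
    refine sup_le ((Subgroup.closure_le _).2 ?_) (Subgroup.center_le_centralizer _)
    rintro _ ⟨k, rfl⟩
    exact Subgroup.mem_centralizer_singleton_iff.2 (h k).symm
  rw [hx] at hle
  exact Subgroup.mem_center_iff.2 fun y =>
    Subgroup.mem_centralizer_singleton_iff.1 (hle (Subgroup.mem_top y))

theorem closure_range_comp_eq_top {f : K →* L} (hf : Function.Surjective f)
    (hx : Subgroup.closure (Set.range x) = ⊤) : Subgroup.closure (Set.range (f ∘ x)) = ⊤ := by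
  rw [Set.range_comp, ← MonoidHom.map_closure, hx, Subgroup.map_top_of_surjective f hf]

theorem closure_range_sup_ker_eq_top {f : K →* L}
    (hx : Subgroup.closure (Set.range (f ∘ x)) = ⊤) :
    Subgroup.closure (Set.range x) ⊔ f.ker = ⊤ := by
  rw [← Subgroup.comap_map_eq, MonoidHom.map_closure, ← Set.range_comp, hx, Subgroup.comap_top]

theorem mk_mem_center_iff (hx : Subgroup.closure (Set.range x) = ⊤) {N : Subgroup K} [N.Normal]
    {y : K} : (y : K ⧸ N) ∈ Subgroup.center (K ⧸ N) ↔ ∀ k, comm y (x k) ∈ N := by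
  have hgen := closure_range_comp_eq_top (QuotientGroup.mk'_surjective N) hx
  rw [mem_center_iff_of_closure_sup_center (by rw [hgen, top_sup_eq])]
  refine forall_congr' fun k => ?_
  rw [← QuotientGroup.eq_one_iff (comm y (x k))]
  exact Eq.congr_left (map_comm (QuotientGroup.mk' N) y (x k)).symm

theorem lowerCentral_two_le_of_closure_eq_top (hx : Subgroup.closure (Set.range x) = ⊤)
    {N : Subgroup K} [N.Normal] (h : ∀ j i, comm (x j) (x i) ∈ N) : lowerCentral 2 K ≤ N := by
  have htop : (Subgroup.center (K ⧸ N)).comap (QuotientGroup.mk' N) = ⊤ := by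
    rw [eq_top_iff, ← hx, Subgroup.closure_le]
    rintro _ ⟨j, rfl⟩
    exact (mk_mem_center_iff hx).2 (h j)
  have hid : Subgroup.closure (Set.range (id : K → K)) = ⊤ := by simp
  refine lowerCentral_two_le fun y => (mk_mem_center_iff hid).1 ?_
  exact htop.ge (Subgroup.mem_top y)

theorem commutator_le_of_sup_center_eq_top {S : Subgroup K} (hS : S ⊔ Subgroup.center K = ⊤) :
    commutator K ≤ S := by
  have : S.Normal := Subgroup.normalizer_eq_top_iff.1 <| top_le_iff.1 <|
    hS.ge.trans (sup_le Subgroup.le_normalizer (Subgroup.center_le_normalizer _))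
  exact Subgroup.Normal.commutator_le_of_self_sup_commutative_eq_top hS inferInstance

theorem closure_range_eq_top_of_abelianization (hK : commutator K ≤ Subgroup.center K)
    (hx : Subgroup.closure (Set.range (Abelianization.of ∘ x)) = ⊤) :
    Subgroup.closure (Set.range x) = ⊤ := by
  have hsup := closure_range_sup_ker_eq_top hx
  rw [Abelianization.ker_of] at hsup
  have hle := commutator_le_of_sup_center_eq_top
    (top_le_iff.1 (hsup.ge.trans (sup_le_sup_left hK _)))
  rwa [sup_eq_left.2 hle] at hsup

theorem normal_of_le_center {N : Subgroup K} (hN : N ≤ Subgroup.center K) : N.Normal := by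
  rw [← Subgroup.commutator_top_right_le_iff,
    Subgroup.commutator_top_right_eq_bot_iff_le_center.2 hN]
  exact bot_le

end Generators

section Complements

variable {K : Type*} [Group K] {C Z N : Subgroup K} [Z.Normal]

theorem sup_inf_eq_of_disjoint {X : Subgroup K} (hX : X ≤ C) (hCZ : C ⊓ Z = ⊥) :
    (X ⊔ Z) ⊓ C = X := by
  refine le_antisymm ?_ (le_inf le_sup_left hX)
  rintro _ ⟨hy, hC⟩
  obtain ⟨a, ha, z, hz, rfl⟩ := Subgroup.mem_sup_of_normal_right.1 hy
  have hz1 : z ∈ C ⊓ Z := ⟨(Subgroup.mul_mem_cancel_left _ (hX ha)).1 hC, hz⟩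
  rw [hCZ, Subgroup.mem_bot] at hz1
  rwa [hz1, mul_one]

theorem inf_sup_eq_of_le (hZN : Z ≤ N) (hN : N ≤ C ⊔ Z) : N ⊓ C ⊔ Z = N := by
  refine le_antisymm (sup_le inf_le_left hZN) fun y hy => ?_
  obtain ⟨c, hc, z, hz, rfl⟩ := Subgroup.mem_sup_of_normal_right.1 (hN hy)
  exact Subgroup.mul_mem_sup ⟨(Subgroup.mul_mem_cancel_right _ (hZN hz)).1 hy, hc⟩ hz

end Complements

section Capable

universe u v

variable {G : Type u} [Group G]

theorem IsCapable.exists_surjective (h : IsCapable G) :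
    ∃ (H : Type u) (_ : Group H) (q : H →* G), Function.Surjective q ∧
      q.ker = Subgroup.center H := by
  obtain ⟨H, _, ⟨e⟩⟩ := h
  refine ⟨H, inferInstance, e.symm.toMonoidHom.comp (QuotientGroup.mk' _),
    e.symm.surjective.comp (QuotientGroup.mk'_surjective _), ?_⟩
  rw [MonoidHom.ker_comp_of_injective _ _ e.symm.injective, QuotientGroup.ker_mk']

theorem isCapable_of_ker_eq_center {L : Type v} [Group L] [Small.{u} L] {f : L →* G}
    (hf : Function.Surjective f) (hker : f.ker = Subgroup.center L) : IsCapable G := by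
  let σ : Shrink.{u} L ≃* L := Shrink.mulEquiv
  have hker' : (f.comp σ.toMonoidHom).ker = Subgroup.center (Shrink.{u} L) := by
    rw [← MonoidHom.comap_ker, hker]
    exact Subgroup.ext fun y => MulEquivClass.apply_mem_center_iff σ
  exact ⟨Shrink.{u} L, inferInstance, ⟨((QuotientGroup.quotientMulEquivOfEq hker'.symm).trans
    (QuotientGroup.quotientKerEquivOfSurjective _ (hf.comp σ.surjective))).symm⟩⟩

end Capable

theorem dvd_choose_two_of_odd {m : ℕ} (hm : Odd m) : m ∣ m.choose 2 := by
  obtain ⟨k, rfl⟩ := hm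
  exact ⟨k, by rw [Nat.choose_two_right, Nat.add_sub_cancel, mul_left_comm,
    Nat.mul_div_cancel_left _ two_pos]⟩

section ClassThree

variable {K : Type*} [Group K] (hK : lowerCentral 4 K = ⊥)
include hK

theorem lowerCentral_three_le_center : lowerCentral 3 K ≤ Subgroup.center K :=
  Subgroup.commutator_top_right_eq_bot_iff_le_center.1 hK

theorem commute_of_mem_three {z : K} (hz : z ∈ lowerCentral 3 K) (x : K) : Commute z x :=
  ((Subgroup.mem_center_iff.1 (lowerCentral_three_le_center hK hz)) x).symm

theorem commute_of_mem_two {v w : K} (hv : v ∈ lowerCentral 2 K) (hw : w ∈ lowerCentral 2 K) :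
    Commute v w := by
  have h : ⁅lowerCentral 2 K, lowerCentral 2 K⁆ = ⊥ := by
    refine Subgroup.commutator_commutator_eq_bot_of_rotate ?_ hK
    rw [Subgroup.commutator_comm ⊤ (lowerCentral 2 K)]
    exact hK
  rw [Subgroup.commutator_eq_bot_iff_le_centralizer] at h
  exact (Subgroup.mem_centralizer_iff.1 (h hv) w hw).symm

theorem comm_mul_left {v w : K} (hv : v ∈ lowerCentral 2 K) (x : K) :
    comm (v * w) x = comm v x * comm w x := by
  have h := commute_of_mem_three hK (comm_mem_lowerCentral_three hv x) w
  calc comm (v * w) x = w⁻¹ * (comm v x * w) * comm w x := by simp [comm, mul_assoc]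
    _ = comm v x * comm w x := by rw [h.eq, inv_mul_cancel_left]

theorem comm_mul_right {v : K} (hv : v ∈ lowerCentral 2 K) (x y : K) :
    comm v (x * y) = comm v x * comm v y := by
  have h := commute_of_mem_three hK (comm_mem_lowerCentral_three hv x)
  calc comm v (x * y) = comm v y * (y⁻¹ * (comm v x * y)) := by simp [comm, mul_assoc]
    _ = comm v x * comm v y := by rw [(h y).eq, inv_mul_cancel_left, (h (comm v y)).eq]

/-- The homomorphism `v ↦ [v, x]` on the derived subgroup of a group of class at most three. -/
def commLeftHom (x : K) : lowerCentral 2 K →* K where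
  toFun v := comm v x
  map_one' := comm_one_left x
  map_mul' v _ := comm_mul_left hK v.2 x

/-- The homomorphism `x ↦ [v, x]` attached to an element `v` of the derived subgroup of a group of
class at most three. -/
def commRightHom {v : K} (hv : v ∈ lowerCentral 2 K) : K →* K where
  toFun := comm v
  map_one' := comm_one_right v
  map_mul' := comm_mul_right hK hv

theorem comm_inv_left {v : K} (hv : v ∈ lowerCentral 2 K) (x : K) :
    comm v⁻¹ x = (comm v x)⁻¹ :=
  map_inv (commLeftHom hK x) ⟨v, hv⟩

theorem comm_pow_left {v : K} (hv : v ∈ lowerCentral 2 K) (x : K) (m : ℕ) :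
    comm (v ^ m) x = comm v x ^ m :=
  map_pow (commLeftHom hK x) ⟨v, hv⟩ m

theorem comm_pow_right {v : K} (hv : v ∈ lowerCentral 2 K) (x : K) (m : ℕ) :
    comm v (x ^ m) = comm v x ^ m :=
  map_pow (commRightHom hK hv) x m

theorem comm_mul_left_of_mem_three {v z : K} (hv : v ∈ lowerCentral 2 K)
    (hz : z ∈ lowerCentral 3 K) (x : K) : comm (v * z) x = comm v x := by
  rw [comm_mul_left hK hv, comm_eq_one_iff.2 (commute_of_mem_three hK hz x), mul_one]

theorem comm_comm_inv_right (x y z : K) : comm (comm x y⁻¹) z = (comm (comm x y) z)⁻¹ := by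
  have h : comm x y⁻¹ = (comm x y)⁻¹ * comm (comm x y)⁻¹ y⁻¹ := by simp [comm, mul_assoc]
  have hinv := inv_mem (comm_mem_lowerCentral_two x y)
  rw [h, comm_mul_left_of_mem_three hK hinv (comm_mem_lowerCentral_three hinv _),
    comm_inv_left hK (comm_mem_lowerCentral_two x y)]

/-- The three factors are central, so this is the Hall–Witt identity without its conjugations. -/
theorem comm_jacobi (x y z : K) :
    comm (comm x y) z * comm (comm y z) x * comm (comm z x) y = 1 := by
  have hall_witt : (y⁻¹ * comm (comm x y⁻¹) z * y) * (z⁻¹ * comm (comm y z⁻¹) x * z) *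
      (x⁻¹ * comm (comm z x⁻¹) y * x) = 1 := by simp [comm, mul_assoc]
  have hcomm (a b c d : K) : Commute (comm (comm a b) c) d :=
    commute_of_mem_three hK (comm_mem_lowerCentral_three (comm_mem_lowerCentral_two a b) c) d
  have hconj (a b c d : K) : d⁻¹ * comm (comm a b) c * d = comm (comm a b) c := by
    rw [mul_assoc, (hcomm a b c d).eq, inv_mul_cancel_left]
  rw [hconj, hconj, hconj, comm_comm_inv_right hK, comm_comm_inv_right hK,
    comm_comm_inv_right hK, ← mul_inv_rev, ← mul_inv_rev, inv_eq_one] at hall_witt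
  rw [(hcomm x y z _).eq, (hcomm z x y _).symm.eq, hall_witt]

theorem mul_comm_pow (x y : K) (m : ℕ) :
    (x * comm x y) ^ m = x ^ m * comm x y ^ m * comm (comm x y) x ^ m.choose 2 := by
  have htwo := comm_mem_lowerCentral_two x y
  have hcomm := commute_of_mem_three hK (comm_mem_lowerCentral_three htwo x)
  induction m with
  | zero => simp
  | succ m ih =>
    have hmove : comm x y ^ m * x = x * comm x y ^ m * comm (comm x y) x ^ m := by
      rw [← comm_pow_left hK htwo, mul_mul_comm]
    rw [pow_succ, ih, Nat.choose_succ_succ' m 1, Nat.choose_one_right, pow_add _ m (m.choose 2),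
      mul_assoc, ((hcomm _).pow_left _).eq]
    calc x ^ m * comm x y ^ m * (x * comm x y * comm (comm x y) x ^ m.choose 2)
        = x ^ m * (comm x y ^ m * x) * comm x y * comm (comm x y) x ^ m.choose 2 := by
          simp only [mul_assoc]
      _ = x ^ (m + 1) * comm x y ^ m * (comm (comm x y) x ^ m * comm x y) *
          comm (comm x y) x ^ m.choose 2 := by
          rw [hmove, pow_succ]; simp only [mul_assoc]
      _ = _ := by
          rw [((hcomm _).pow_left _).eq, pow_succ (comm x y)]; simp only [mul_assoc]

theorem comm_pow_eq_one {m : ℕ} (hm : Odd m) {x y : K} (hxy : Commute (x ^ m) y) :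
    comm x y ^ m = 1 := by
  have htwo := comm_mem_lowerCentral_two x y
  have hconj : (x * comm x y) ^ m = x ^ m := by
    have : x * comm x y = y⁻¹ * x * y⁻¹⁻¹ := by simp [comm, mul_assoc]
    rw [this, conj_pow, inv_inv, mul_assoc, hxy.eq, inv_mul_cancel_left]
  have htriple : comm (comm x y) x ^ m = 1 := by
    have hx : Commute (x ^ m) x := (Commute.refl x).pow_left m
    rw [← comm_pow_right hK htwo, comm_eq_one_iff]
    exact (((hx.inv_right.mul_right hxy.inv_right).mul_right hx).mul_right hxy).symm
  obtain ⟨c, hc⟩ := dvd_choose_two_of_odd hm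
  rw [mul_comm_pow hK, hc, pow_mul, htriple, one_pow, mul_one] at hconj
  exact mul_eq_left.1 hconj

end ClassThree

section Linear

theorem eq_zero_of_dual_family {R M ι : Type*} [Ring R] [NoZeroDivisors R] [AddCommGroup M]
    [Module R M] {b : ι → M} (hb : Submodule.span R (Set.range b) = ⊤) {l : ι → M →ₗ[R] R}
    (hdiag : ∀ s, l s (b s) ≠ 0) (hoff : ∀ s t, t ≠ s → l s (b t) = 0) {x : M}
    (hx : ∀ s, l s x = 0) : x = 0 := by
  obtain ⟨c, rfl⟩ := Finsupp.mem_span_range_iff_exists_finsupp.1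
    (hb.ge (Submodule.mem_top (x := x)))
  have hc (s) (hs : s ∈ c.support) : c s = 0 := by
    have h := hx s
    rw [Finsupp.sum, map_sum, Finset.sum_eq_single_of_mem s hs fun t _ hts => by
      rw [map_smul, hoff s t hts, smul_zero], map_smul, smul_eq_mul] at h
    exact (mul_eq_zero.1 h).resolve_right (hdiag s)
  exact Finset.sum_eq_zero fun s hs => by simp only [hc s hs, zero_smul]

theorem eq_top_of_basis_mem {R M ι : Type*} [Semiring R] [AddCommMonoid M] [Module R M]
    (b : Module.Basis ι R M) {S : Submodule R M} (hS : ∀ i, b i ∈ S) : S = ⊤ := by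
  rw [eq_top_iff, ← b.span_eq, Submodule.span_le]
  exact Set.range_subset_iff.2 hS

variable {R : Type*} [Field R] {U : Type*} [AddCommGroup U] [Module R U]

theorem wedge_self (a : U) : wedge R a a = 0 :=
  (exteriorPower.ιMulti R 2).map_eq_zero_of_eq ![a, a] (i := 0) (j := 1) (by simp) (by decide)

theorem wedge_swap (a b : U) : wedge R b a = -wedge R a b := by
  have h := (exteriorPower.ιMulti R 2 (M := U)).map_swap ![a, b] (i := 0) (j := 1) (by decide)
  rwa [show ![a, b] ∘ Equiv.swap (0 : Fin 2) 1 = ![b, a] by ext i; fin_cases i <;> simp] at h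

theorem wedge_add_left (a a' b : U) : wedge R (a + a') b = wedge R a b + wedge R a' b :=
  (exteriorPower.ιMulti R 2).map_vecCons_add ![b] a a'

theorem wedge_smul_left (r : R) (a b : U) : wedge R (r • a) b = r • wedge R a b :=
  (exteriorPower.ιMulti R 2).map_vecCons_smul ![b] r a

variable (R U) in
/-- The wedge product as a bilinear map. -/
def wedgeBilin : U →ₗ[R] U →ₗ[R] V R U :=
  LinearMap.mk₂ R (wedge R) wedge_add_left wedge_smul_left
    (fun a b b' => by
      rw [wedge_swap, wedge_add_left, wedge_swap a b, wedge_swap a b', neg_add, neg_neg, neg_neg])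
    (fun r a b => by rw [wedge_swap, wedge_smul_left, wedge_swap a b, smul_neg, neg_neg])

variable (R U) in
/-- The map `(a, v) ↦ φ_a(v)` as a bilinear map. -/
def phiBilin : U →ₗ[R] V R U →ₗ[R] W R U :=
  (TensorProduct.mk R (V R U) U).flip.compr₂ (J R U).mkQ

theorem span_range_wedge : Submodule.span R (Set.range fun a : U × U => wedge R a.1 a.2) = ⊤ := by
  refine top_le_iff.1 ((exteriorPower.ιMulti_span R 2 U).ge.trans (Submodule.span_mono ?_))
  rintro _ ⟨a, rfl⟩
  refine ⟨(a 0, a 1), congrArg (exteriorPower.ιMulti R 2) ?_⟩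
  ext i
  fin_cases i <;> rfl

theorem phi_jacobi (a b c : U) :
    phi R c (wedge R a b) + phi R a (wedge R b c) + phi R b (wedge R c a) = 0 :=
  (Submodule.Quotient.mk_eq_zero _).2 (Submodule.subset_span ⟨a, b, c, rfl⟩)

section Basis

variable {ι : Type*} (u : Module.Basis ι R U)

theorem eq_top_of_wedge_mem [LinearOrder ι] {S : Submodule R (V R U)}
    (hS : ∀ i j, i < j → wedge R (u j) (u i) ∈ S) : S = ⊤ := by
  have hbasis (j i) : wedge R (u j) (u i) ∈ S := by
    rcases lt_trichotomy i j with h | rfl | h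
    · exact hS i j h
    · rw [wedge_self]; exact S.zero_mem
    · rw [wedge_swap]; exact S.neg_mem (hS j i h)
  have hzero : (wedgeBilin R U).compr₂ S.mkQ = 0 :=
    u.ext fun j => u.ext fun i => (Submodule.Quotient.mk_eq_zero S).2 (hbasis j i)
  rw [eq_top_iff, ← span_range_wedge, Submodule.span_le]
  rintro _ ⟨⟨a, b⟩, rfl⟩
  exact (Submodule.Quotient.mk_eq_zero S).1 (LinearMap.congr_fun₂ hzero a b)

theorem forall_phi_mem_iff {S : Submodule R (W R U)} {v : V R U} :
    (∀ a, phi R a v ∈ S) ↔ ∀ k, phi R (u k) v ∈ S := by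
  refine ⟨fun h k => h (u k), fun h a => ?_⟩
  have htop : S.comap ((phiBilin R U).flip v) = ⊤ := eq_top_of_basis_mem u h
  exact htop.ge (Submodule.mem_top (x := a))

theorem eq_top_of_phi_mem {S : Submodule R (W R U)} (hS : ∀ k v, phi R (u k) v ∈ S) :
    S = ⊤ := by
  refine eq_top_iff.2 fun w _ => ?_
  obtain ⟨t, rfl⟩ := (J R U).mkQ_surjective w
  induction t with
  | zero => exact S.zero_mem
  | add x y hx hy => exact S.add_mem (hx trivial) (hy trivial)
  | tmul v a => exact (forall_phi_mem_iff u).2 (fun k => hS k v) a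

/-- The Jacobi identity expresses the remaining `φ_k(u_j ∧ u_i)`, those with `k < i < j`, through
the given ones. -/
theorem eq_top_of_phi_wedge_mem [LinearOrder ι] {S : Submodule R (W R U)}
    (hS : ∀ i j k, i < j → i ≤ k → phi R (u k) (wedge R (u j) (u i)) ∈ S) : S = ⊤ := by
  refine eq_top_of_phi_mem u fun k v => ?_
  suffices h : S.comap (phi R (u k)) = ⊤ from h.ge (Submodule.mem_top (x := v))
  refine eq_top_of_wedge_mem u fun i j hij => ?_
  rcases le_or_gt i k with hik | hki
  · exact hS i j k hij hik
  · have h := phi_jacobi (R := R) (u j) (u i) (u k)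
    rw [wedge_swap (u j) (u k), map_neg, ← sub_eq_add_neg, sub_eq_zero] at h
    rw [Submodule.mem_comap, eq_sub_of_add_eq h]
    exact S.sub_mem (hS k j i (hki.trans hij) hki.le) (hS k i j hki (hki.trans hij).le)

variable {A : Type*} [AddCommGroup A] [Module R A]

/-- The linear map on `V` induced by an alternating bilinear map. -/
noncomputable def liftWedge (B : U →ₗ[R] U →ₗ[R] A) (hB : B.IsAlt) : V R U →ₗ[R] A :=
  exteriorPower.alternatingMapLinearEquiv
    { toFun := fun m => B (m 0) (m 1)
      map_update_add' := fun m i x y => by fin_cases i <;> simp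
      map_update_smul' := fun m i r x => by fin_cases i <;> simp
      map_eq_zero_of_eq' := fun m i j h hij => by
        have h01 : m 0 = m 1 := by fin_cases i <;> fin_cases j <;> simp_all
        rw [h01, hB] }

theorem liftWedge_wedge (B : U →ₗ[R] U →ₗ[R] A) (hB : B.IsAlt) (a b : U) :
    liftWedge B hB (wedge R a b) = B a b :=
  exteriorPower.alternatingMapLinearEquiv_apply_ιMulti _ _

theorem isAlt_of_basis {B : U →ₗ[R] U →ₗ[R] A} (hself : ∀ i, B (u i) (u i) = 0)
    (hswap : ∀ i j, B (u j) (u i) = -B (u i) (u j)) : B.IsAlt := by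
  have hflip : B.flip = -B := u.ext fun i => u.ext fun j => hswap i j
  intro a
  induction u.mem_span a using Submodule.span_induction with
  | mem _ h => obtain ⟨i, rfl⟩ := h; exact hself i
  | zero => simp
  | add x y _ _ hx hy =>
    have hyx : B y x = -B x y := LinearMap.congr_fun₂ hflip x y
    simp [hx, hy, hyx]
  | smul r x _ hx => simp [hx]

theorem exists_linearMap_wedge {c : ι → ι → A} (hself : ∀ i, c i i = 0)
    (hswap : ∀ i j, c j i = -c i j) :
    ∃ f : V R U →ₗ[R] A, ∀ i j, f (wedge R (u i) (u j)) = c i j := by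
  let B : U →ₗ[R] U →ₗ[R] A := u.constr R fun i => u.constr R (c i)
  have hB (i j) : B (u i) (u j) = c i j := by simp [B]
  have hAlt : B.IsAlt := isAlt_of_basis u (by simpa only [hB]) (by simpa only [hB])
  exact ⟨liftWedge B hAlt, fun i j => by rw [liftWedge_wedge, hB]⟩

/-- The cyclic rotation `(a, b, c) ↦ T(b, c, a)` of a trilinear map. -/
def rotate (T : U →ₗ[R] U →ₗ[R] U →ₗ[R] A) : U →ₗ[R] U →ₗ[R] U →ₗ[R] A :=
  (LinearMap.lflip.comp T).flip

theorem exists_linearMap_phi (f : V R U →ₗ[R] A) {D : ι → A →ₗ[R] A}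
    (hD : ∀ i j k, D k (f (wedge R (u i) (u j))) + D i (f (wedge R (u j) (u k)))
      + D j (f (wedge R (u k) (u i))) = 0) :
    ∃ h : W R U →ₗ[R] A, ∀ k v, h (phi R (u k) v) = D k (f v) := by
  let E : U →ₗ[R] A →ₗ[R] A := u.constr R D
  have hE (k) : E (u k) = D k := by simp [E]
  let T : U →ₗ[R] U →ₗ[R] U →ₗ[R] A := (wedgeBilin R U).compr₂ (E.flip.comp f)
  have hT (a b c) : T a b c = E c (f (wedge R a b)) := rfl
  have hJacobi : T + rotate T + rotate (rotate T) = 0 :=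
    u.ext fun i => u.ext fun j => u.ext fun k => by
      change T (u i) (u j) (u k) + T (u j) (u k) (u i) + T (u k) (u i) (u j) = 0
      simpa only [hT, hE] using hD i j k
  have hJ : J R U ≤ LinearMap.ker (TensorProduct.lift (E.flip.comp f)) := by
    rw [J, Submodule.span_le]
    rintro _ ⟨a, b, c, rfl⟩
    rw [SetLike.mem_coe, LinearMap.mem_ker, map_add, map_add]
    exact LinearMap.congr_fun (LinearMap.congr_fun₂ hJacobi a b) c
  exact ⟨(J R U).liftQ _ hJ, fun k v => by rw [← hE]; rfl⟩

end Basis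

end Linear

section Star

variable {R X Y ι : Type*} [Field R] [AddCommGroup X] [Module R X] [AddCommGroup Y] [Module R Y]

theorem gc_upStar_downStar (l : ι → X →ₗ[R] Y) : GaloisConnection (upStar l) (downStar l) := by
  intro A B
  simp only [upStar, downStar, Submodule.span_le, Set.iUnion_subset_iff, Set.image_subset_iff,
    le_iInf_iff]
  rfl

theorem isClosedFor_downStar (l : ι → X →ₗ[R] Y) (B : Submodule R Y) :
    IsClosedFor l (downStar l B) :=
  ((gc_upStar_downStar l).u_l_u_eq_u B).symm

theorem mem_downStar_phi_iff {U : Type*} [AddCommGroup U] [Module R U]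
    (u : Module.Basis ι R U) {B : Submodule R (W R U)} {v : V R U} :
    v ∈ downStar (phi R : U → _) B ↔ ∀ k, phi R (u k) v ∈ B := by
  rw [← forall_phi_mem_iff u, downStar, Submodule.mem_iInf]
  rfl

end Star

section CommutatorPair

variable {K : Type*} [Group K]

/-- The elements of the derived subgroup of a group of class at most three that are killed by `p`;
they form a vector space over `𝔽_p`. -/
def derivedTorsion (p : ℕ) (hK : lowerCentral 4 K = ⊥) : Subgroup K where
  carrier := {a | a ∈ lowerCentral 2 K ∧ a ^ p = 1}
  one_mem' := ⟨one_mem _, one_pow p⟩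
  mul_mem' ha hb := ⟨mul_mem ha.1 hb.1, by
    rw [(commute_of_mem_two hK ha.1 hb.1).mul_pow, ha.2, hb.2, one_mul]⟩
  inv_mem' ha := ⟨inv_mem ha.1, by rw [inv_pow, ha.2, inv_one]⟩

instance (p : ℕ) (hK : lowerCentral 4 K = ⊥) : CommGroup (derivedTorsion p hK) where
  mul_comm a b := Subtype.ext (commute_of_mem_two hK a.2.1 b.2.1).eq

instance (p : ℕ) (hK : lowerCentral 4 K = ⊥) : Module (ZMod p) (Additive (derivedTorsion p hK)) :=
  AddCommGroup.zmodModule (n := p) fun a =>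
    Additive.toMul.injective (Subtype.ext (Additive.toMul a).2.2)

/-- The endomorphism `a ↦ [a, x]` of the `p`-torsion of the derived subgroup. -/
def commEnd (p : ℕ) (hK : lowerCentral 4 K = ⊥) (x : K) :
    derivedTorsion p hK →* derivedTorsion p hK :=
  ((commLeftHom hK x).comp (Subgroup.inclusion fun _ => And.left)).codRestrict _ fun a =>
    ⟨comm_mem_lowerCentral_two _ x, (comm_pow_left hK a.2.1 x p).symm.trans
      (by rw [a.2.2, comm_one_left])⟩

/-- The preimage of a subgroup under a homomorphism defined on an `𝔽_p`-vector space. -/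
def comapSubmodule (p : ℕ) {M : Type*} [AddCommGroup M] [Module (ZMod p) M]
    (f : Multiplicative M →* K) (S : Subgroup K) : Submodule (ZMod p) M :=
  AddSubgroup.toZModSubmodule p (S.comap f).toAddSubgroup'

variable {p : ℕ} [Fact p.Prime] {U : Type*} [AddCommGroup U] [Module (ZMod p) U] {ι : Type*}
  {u : Module.Basis ι (ZMod p) U} {x : ι → K}

variable (u x) in
/-- Homomorphisms `α : V → K` and `β : W → K` form a commutator pair for the family `x` of elements
of `K` if `α` sends `u_j ∧ u_i` to `[x_j, x_i]`, and `β` turns `φ_{u_k}` into commutation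
with `x_k`. -/
structure IsCommutatorPair (α : Multiplicative (V (ZMod p) U) →* K)
    (β : Multiplicative (W (ZMod p) U) →* K) : Prop where
  wedge : ∀ j i, α (.ofAdd (wedge (ZMod p) (u j) (u i))) = comm (x j) (x i)
  phi : ∀ k v, β (.ofAdd (phi (ZMod p) (u k) v)) = comm (α (.ofAdd v)) (x k)

variable (u) in
theorem exists_isCommutatorPair (hp : p ≠ 2) (hK : lowerCentral 4 K = ⊥)
    (hx : ∀ i j, Commute (x i ^ p) (x j)) : ∃ α β, IsCommutatorPair u x α β := by
  have hodd : Odd p := (Fact.out : p.Prime).odd_of_ne_two hp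
  let c (i j : ι) : derivedTorsion p hK :=
    ⟨comm (x i) (x j), comm_mem_lowerCentral_two _ _, comm_pow_eq_one hK hodd (hx i j)⟩
  obtain ⟨f, hf⟩ := exists_linearMap_wedge u (c := fun i j => Additive.ofMul (c i j))
    (fun i => congrArg Additive.ofMul (Subtype.ext (comm_self (x i))))
    fun i j => congrArg Additive.ofMul (Subtype.ext (comm_inv (x i) (x j)).symm)
  obtain ⟨h, hh⟩ := exists_linearMap_phi u f
    (D := fun k => (MonoidHom.toAdditive (commEnd p hK (x k))).toZModLinearMap p)
    fun i j k => by
      simp only [hf]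
      exact congrArg Additive.ofMul (Subtype.ext (comm_jacobi hK (x i) (x j) (x k)))
  refine ⟨(derivedTorsion p hK).subtype.comp (AddMonoidHom.toMultiplicativeLeft f.toAddMonoidHom),
    (derivedTorsion p hK).subtype.comp (AddMonoidHom.toMultiplicativeLeft h.toAddMonoidHom),
    fun j i => ?_, fun k v => ?_⟩
  · exact congrArg (fun a => ((Additive.toMul a : derivedTorsion p hK) : K)) (hf j i)
  · exact congrArg (fun a => ((Additive.toMul a : derivedTorsion p hK) : K)) (hh k v)

variable {α α' : Multiplicative (V (ZMod p) U) →* K} {β β' : Multiplicative (W (ZMod p) U) →* K}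

section Span

variable [LinearOrder ι]

variable (u) in
theorem apply_mem_of_wedge_mem {S : Subgroup K}
    (hS : ∀ i j, i < j → α (.ofAdd (wedge (ZMod p) (u j) (u i))) ∈ S) (v) : α v ∈ S := by
  have htop : comapSubmodule p α S = ⊤ := eq_top_of_wedge_mem u hS
  exact htop.ge (Submodule.mem_top (x := Multiplicative.toAdd v))

variable (u) in
theorem apply_mem_of_phi_wedge_mem {S : Subgroup K}
    (hS : ∀ i j k, i < j → β (.ofAdd (phi (ZMod p) (u k) (wedge (ZMod p) (u j) (u i)))) ∈ S) (w) :
    β w ∈ S := by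
  have htop : comapSubmodule p β S = ⊤ := eq_top_of_phi_wedge_mem u fun i j k hij _ => hS i j k hij
  exact htop.ge (Submodule.mem_top (x := Multiplicative.toAdd w))

variable (u) in
theorem hom_ext_wedge (h : ∀ j i, α (.ofAdd (wedge (ZMod p) (u j) (u i))) =
    α' (.ofAdd (wedge (ZMod p) (u j) (u i)))) : α = α' :=
  MonoidHom.ext (apply_mem_of_wedge_mem u (α := MonoidHom.id _) (S := α.eqLocus α')
    fun i j _ => h j i)

variable (u) in
theorem hom_ext_phi_wedge
    (h : ∀ j i k, β (.ofAdd (phi (ZMod p) (u k) (wedge (ZMod p) (u j) (u i)))) =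
      β' (.ofAdd (phi (ZMod p) (u k) (wedge (ZMod p) (u j) (u i))))) : β = β' :=
  MonoidHom.ext (apply_mem_of_phi_wedge_mem u (β := MonoidHom.id _) (S := β.eqLocus β')
    fun i j k _ => h j i k)

end Span

theorem normal_of_lowerCentral_three_le {S : Subgroup K} (h₃ : lowerCentral 3 K ≤ S)
    (h₂ : S ≤ lowerCentral 2 K) : S.Normal :=
  Subgroup.commutator_top_right_le_iff.1 ((Subgroup.commutator_mono h₂ le_rfl).trans h₃)

namespace IsCommutatorPair

theorem map {L : Type*} [Group L] (h : IsCommutatorPair u x α β) (f : K →* L) :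
    IsCommutatorPair u (f ∘ x) (f.comp α) (f.comp β) where
  wedge j i := by simp only [MonoidHom.comp_apply, Function.comp_apply, h.wedge, map_comm]
  phi k v := by simp only [MonoidHom.comp_apply, Function.comp_apply, h.phi, map_comm]

variable [LinearOrder ι]

theorem left_unique (h : IsCommutatorPair u x α β) (h' : IsCommutatorPair u x α' β') :
    α = α' :=
  hom_ext_wedge u fun j i => by rw [h.wedge, h'.wedge]

theorem left_mem (h : IsCommutatorPair u x α β) (v) : α v ∈ lowerCentral 2 K :=
  apply_mem_of_wedge_mem u (fun i j _ => by
    rw [h.wedge]; exact comm_mem_lowerCentral_two _ _) v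

theorem right_mem (h : IsCommutatorPair u x α β) (w) : β w ∈ lowerCentral 3 K :=
  apply_mem_of_phi_wedge_mem u (fun i j k _ => by
    rw [h.phi]; exact comm_mem_lowerCentral_three (h.left_mem _) _) w

theorem comm_mul (h : IsCommutatorPair u x α β) (hK : lowerCentral 4 K = ⊥) (v : V (ZMod p) U)
    (w) (k : ι) :
    comm (α (.ofAdd v) * β w) (x k) = β (.ofAdd (CapableGroups.phi (ZMod p) (u k) v)) := by
  rw [comm_mul_left_of_mem_three hK (h.left_mem _) (h.right_mem w), h.phi]

theorem sup_lowerCentral_three (h : IsCommutatorPair u x α β)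
    (hx : Subgroup.closure (Set.range x) = ⊤) :
    α.range ⊔ lowerCentral 3 K = lowerCentral 2 K := by
  have hle : α.range ⊔ lowerCentral 3 K ≤ lowerCentral 2 K :=
    sup_le (by rintro _ ⟨v, rfl⟩; exact h.left_mem v) lowerCentral_three_le_two
  have := normal_of_lowerCentral_three_le le_sup_right hle
  refine hle.antisymm (lowerCentral_two_le_of_closure_eq_top hx fun j i => ?_)
  rw [← h.wedge j i]
  exact Subgroup.mem_sup_left ⟨_, rfl⟩

theorem right_range (h : IsCommutatorPair u x α β) (hK : lowerCentral 4 K = ⊥)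
    (hx : Subgroup.closure (Set.range x) = ⊤) :
    β.range = lowerCentral 3 K := by
  refine le_antisymm (by rintro _ ⟨w, rfl⟩; exact h.right_mem w)
    (lowerCentral_three_le fun y hy z => ?_)
  rw [← h.sup_lowerCentral_three hx, Subgroup.mem_sup_of_normal_right] at hy
  obtain ⟨_, ⟨v, rfl⟩, c, hc, rfl⟩ := hy
  rw [comm_mul_left_of_mem_three hK (h.left_mem v) hc]
  have hle : Subgroup.closure (Set.range x) ≤ β.range.comap (commRightHom hK (h.left_mem v)) := by
    rw [Subgroup.closure_le]
    rintro _ ⟨k, rfl⟩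
    exact ⟨_, h.phi k (Multiplicative.toAdd v)⟩
  exact hle (hx.ge (Subgroup.mem_top z))

end IsCommutatorPair

end CommutatorPair

section Unitriangular

/-- A unitriangular `4 × 4` matrix, given by its entries above the diagonal. These matrices form a
group of class three, whose representations of `F` detect the elements of `F_2`. -/
@[ext] structure Unitriangular (R : Type*) where
  e₁₂ : R
  e₂₃ : R
  e₃₄ : R
  e₁₃ : R
  e₂₄ : R
  e₁₄ : R

namespace Unitriangular

variable {R : Type*} [CommRing R]

instance : One (Unitriangular R) := ⟨⟨0, 0, 0, 0, 0, 0⟩⟩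

instance : Mul (Unitriangular R) where
  mul x y := ⟨x.e₁₂ + y.e₁₂, x.e₂₃ + y.e₂₃, x.e₃₄ + y.e₃₄, x.e₁₃ + y.e₁₃ + x.e₁₂ * y.e₂₃,
    x.e₂₄ + y.e₂₄ + x.e₂₃ * y.e₃₄, x.e₁₄ + y.e₁₄ + x.e₁₂ * y.e₂₄ + x.e₁₃ * y.e₃₄⟩

instance : Inv (Unitriangular R) where
  inv x := ⟨-x.e₁₂, -x.e₂₃, -x.e₃₄, -x.e₁₃ + x.e₁₂ * x.e₂₃, -x.e₂₄ + x.e₂₃ * x.e₃₄,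
    -x.e₁₄ + x.e₁₂ * x.e₂₄ + x.e₁₃ * x.e₃₄ - x.e₁₂ * x.e₂₃ * x.e₃₄⟩

theorem one_def : (1 : Unitriangular R) = ⟨0, 0, 0, 0, 0, 0⟩ := rfl

theorem mul_def (x y : Unitriangular R) : x * y =
    ⟨x.e₁₂ + y.e₁₂, x.e₂₃ + y.e₂₃, x.e₃₄ + y.e₃₄, x.e₁₃ + y.e₁₃ + x.e₁₂ * y.e₂₃,
      x.e₂₄ + y.e₂₄ + x.e₂₃ * y.e₃₄, x.e₁₄ + y.e₁₄ + x.e₁₂ * y.e₂₄ + x.e₁₃ * y.e₃₄⟩ := rfl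

theorem inv_def (x : Unitriangular R) : x⁻¹ =
    ⟨-x.e₁₂, -x.e₂₃, -x.e₃₄, -x.e₁₃ + x.e₁₂ * x.e₂₃, -x.e₂₄ + x.e₂₃ * x.e₃₄,
      -x.e₁₄ + x.e₁₂ * x.e₂₄ + x.e₁₃ * x.e₃₄ - x.e₁₂ * x.e₂₃ * x.e₃₄⟩ := rfl

instance : Group (Unitriangular R) :=
  Group.ofLeftAxioms
    (fun x y z => by ext <;> simp only [mul_def] <;> ring)
    (fun x => by ext <;> simp [mul_def, one_def])
    (fun x => by ext <;> simp only [mul_def, inv_def, one_def] <;> ring)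

variable (R) in
/-- The subgroup of matrices with vanishing first superdiagonal; it contains the derived
subgroup. -/
def two : Subgroup (Unitriangular R) where
  carrier := {x | x.e₁₂ = 0 ∧ x.e₂₃ = 0 ∧ x.e₃₄ = 0}
  one_mem' := ⟨rfl, rfl, rfl⟩
  mul_mem' := by rintro x y ⟨h₁, h₂, h₃⟩ ⟨h₄, h₅, h₆⟩; simp [mul_def, *]
  inv_mem' := by rintro x ⟨h₁, h₂, h₃⟩; simp [inv_def, *]

variable (R) in
/-- The subgroup of matrices with vanishing first and second superdiagonals; it contains the third
term of the lower central series. -/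
def three : Subgroup (Unitriangular R) where
  carrier := {x | x ∈ two R ∧ x.e₁₃ = 0 ∧ x.e₂₄ = 0}
  one_mem' := ⟨one_mem _, rfl, rfl⟩
  mul_mem' := by
    rintro x y ⟨hx, h₁, h₂⟩ ⟨hy, h₃, h₄⟩
    exact ⟨mul_mem hx hy, by simp [mul_def, hx.1, h₁, h₃], by simp [mul_def, hx.2.1, h₂, h₄]⟩
  inv_mem' := by
    rintro x ⟨hx, h₁, h₂⟩
    exact ⟨inv_mem hx, by simp [inv_def, hx.1, h₁], by simp [inv_def, hx.2.1, h₂]⟩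

variable (R) in
/-- The entry `(1, 3)` as a homomorphism on the matrices with vanishing first superdiagonal. -/
def entry₁₃ : two R →* Multiplicative R where
  toFun x := .ofAdd x.1.e₁₃
  map_one' := rfl
  map_mul' x y := by simp [mul_def, x.2.1, ← ofAdd_add]

variable (R) in
/-- The entry `(1, 4)` as a homomorphism on the matrices with vanishing first superdiagonal. -/
def entry₁₄ : two R →* Multiplicative R where
  toFun x := .ofAdd x.1.e₁₄
  map_one' := rfl
  map_mul' x y := by simp [mul_def, x.2.1, y.2.2.2, ← ofAdd_add]

theorem comm_e₁₃ (x y : Unitriangular R) :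
    (comm x y).e₁₃ = x.e₁₂ * y.e₂₃ - y.e₁₂ * x.e₂₃ := by
  simp only [comm, mul_def, inv_def]; ring

theorem comm_e₂₄ (x y : Unitriangular R) :
    (comm x y).e₂₄ = x.e₂₃ * y.e₃₄ - y.e₂₃ * x.e₃₄ := by
  simp only [comm, mul_def, inv_def]; ring

theorem comm_mem_two (x y : Unitriangular R) : comm x y ∈ two R := by
  refine ⟨?_, ?_, ?_⟩ <;> simp only [comm, mul_def, inv_def] <;> ring

theorem comm_eq_of_mem_two {x : Unitriangular R} (hx : x ∈ two R) (y : Unitriangular R) :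
    comm x y = ⟨0, 0, 0, 0, 0, x.e₁₃ * y.e₃₄ - y.e₁₂ * x.e₂₄⟩ := by
  obtain ⟨h₁, h₂, h₃⟩ := hx
  ext <;> simp only [comm, mul_def, inv_def, h₁, h₂, h₃] <;> ring

theorem lowerCentral_two_le_two : lowerCentral 2 (Unitriangular R) ≤ two R :=
  lowerCentral_two_le comm_mem_two

theorem lowerCentral_three_le_three : lowerCentral 3 (Unitriangular R) ≤ three R :=
  lowerCentral_three_le fun v hv x => by
    rw [comm_eq_of_mem_two (lowerCentral_two_le_two hv)]
    exact ⟨⟨rfl, rfl, rfl⟩, rfl, rfl⟩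

theorem lowerCentral_four : lowerCentral 4 (Unitriangular R) = ⊥ := by
  refine Subgroup.commutator_top_right_eq_bot_iff_le_center.2 fun z hz => ?_
  obtain ⟨htwo, h₁₃, h₂₄⟩ := lowerCentral_three_le_three hz
  refine Subgroup.mem_center_iff.2 fun y => (comm_eq_one_iff.1 ?_).symm
  rw [comm_eq_of_mem_two htwo, h₁₃, h₂₄, zero_mul, mul_zero, sub_zero, one_def]

/-- The unitriangular matrix with first superdiagonal `a, b, c` and no other entries above the
diagonal. -/
def ofSuperdiagonal (a b c : R) : Unitriangular R := ⟨a, b, c, 0, 0, 0⟩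

theorem ofSuperdiagonal_pow {a b c : R} (h : a * b * c = 0) (m : ℕ) :
    ofSuperdiagonal a b c ^ m =
      ⟨m * a, m * b, m * c, m.choose 2 * (a * b), m.choose 2 * (b * c), 0⟩ := by
  induction m with
  | zero => simp [one_def]
  | succ m ih =>
    rw [pow_succ, ih, mul_def, Nat.choose_succ_succ' m 1, Nat.choose_one_right]
    simp only [ofSuperdiagonal, mk.injEq]
    push_cast
    refine ⟨by ring, by ring, by ring, by ring, by ring, ?_⟩
    linear_combination (m.choose 2 : R) * h

theorem ofSuperdiagonal_pow_eq_one {m : ℕ} (hm : Odd m) (hmR : (m : R) = 0) {a b c : R}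
    (h : a * b * c = 0) : ofSuperdiagonal a b c ^ m = 1 := by
  obtain ⟨k, hk⟩ := dvd_choose_two_of_odd hm
  rw [ofSuperdiagonal_pow h, hk, Nat.cast_mul, hmR, one_def]
  simp only [zero_mul]

end Unitriangular

end Unitriangular

section FGroup

theorem lowerCentral_quotient_eq_bot {K : Type*} [Group K] (k : ℕ) :
    lowerCentral k (K ⧸ lowerCentral k K) = ⊥ := by
  have hmap := Subgroup.map_lowerCentralSeries ⊤ (QuotientGroup.mk' (lowerCentral k K)) (k - 1)
  rw [Subgroup.map_top_of_surjective _ (QuotientGroup.mk'_surjective _)] at hmap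
  exact hmap.symm.trans (by rw [Subgroup.map_eq_bot_iff, QuotientGroup.ker_mk'])

variable {p n : ℕ}

theorem lowerCentral_four_F : lowerCentral 4 (F p n) = ⊥ :=
  lowerCentral_quotient_eq_bot 4

theorem gen_pow (i : Fin n) : gen p i ^ p = 1 := by
  rw [gen, ← QuotientGroup.mk_pow, ← map_pow, ← ofAdd_nsmul, nsmul_one, ZMod.natCast_self,
    ofAdd_zero, map_one]
  rfl

theorem closure_range_gen : Subgroup.closure (Set.range (gen p : Fin n → F p n)) = ⊤ := by
  rw [eq_top_iff]
  rintro f -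
  obtain ⟨m, rfl⟩ := QuotientGroup.mk_surjective f
  induction m using Monoid.CoprodI.induction_on with
  | one => exact one_mem _
  | mul x y hx hy => exact mul_mem hx hy
  | of i z =>
    have hz : z = (Multiplicative.ofAdd 1) ^ (ZMod.cast (Multiplicative.toAdd z) : ℤ) := by
      rw [← ofAdd_zsmul]; simp
    rw [hz, map_zpow]
    have hi : gen p i ∈ Subgroup.closure (Set.range (gen p : Fin n → F p n)) :=
      Subgroup.subset_closure ⟨i, rfl⟩
    exact zpow_mem hi _

theorem cyclicHom_one {L : Type*} [Group L] {g : L} (hg : g ^ p = 1) :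
    cyclicHom g hg (.ofAdd 1) = g := by
  have h : (1 : ZMod p) = ((1 : ℤ) : ZMod p) := Int.cast_one.symm
  rw [cyclicHom, AddMonoidHom.coe_toMultiplicativeLeft, Function.comp_apply, Function.comp_apply,
    toAdd_ofAdd, h, ZMod.lift_coe]
  exact zpow_one g

theorem exists_hom_F {L : Type*} [Group L] (hL : lowerCentral 4 L = ⊥) {x : Fin n → L}
    (hx : ∀ i, x i ^ p = 1) : ∃ f : F p n →* L, f ∘ gen p = x :=
  ⟨NilpotentProduct.lift (k := 3) hL fun i => cyclicHom (x i) (hx i), funext fun i => by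
    simp only [Function.comp_apply, NilpotentProduct.lift, gen, QuotientGroup.lift_mk,
      Monoid.CoprodI.lift_of, cyclicHom_one]⟩

end FGroup

section Functionals

open Unitriangular

variable {p n : ℕ} [Fact p.Prime] {U : Type*} [AddCommGroup U] [Module (ZMod p) U]
  {u : Module.Basis (Fin n) (ZMod p) U} {α : Multiplicative (V (ZMod p) U) →* F p n}
  {β : Multiplicative (W (ZMod p) U) →* F p n}

theorem exists_unitriangular_hom (hp : p ≠ 2) {a b c : Fin n → ZMod p}
    (h : ∀ i, a i * b i * c i = 0) :
    ∃ f : F p n →* Unitriangular (ZMod p),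
      f ∘ gen p = fun i => ofSuperdiagonal (a i) (b i) (c i) :=
  exists_hom_F lowerCentral_four fun i => ofSuperdiagonal_pow_eq_one
    ((Fact.out : p.Prime).odd_of_ne_two hp) (ZMod.natCast_self p) (h i)

theorem exists_functional_wedge (hp : p ≠ 2) (h : IsCommutatorPair u (gen p) α β)
    (a b : Fin n → ZMod p) :
    ∃ l : V (ZMod p) U →ₗ[ZMod p] ZMod p,
      (∀ j i, l (wedge (ZMod p) (u j) (u i)) = a j * b i - a i * b j) ∧
      ∀ v, α (.ofAdd v) ∈ lowerCentral 3 (F p n) → l v = 0 := by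
  obtain ⟨f, hf⟩ := exists_unitriangular_hom (c := 0) hp fun i => mul_zero (a i * b i)
  have hpair := h.map f
  rw [hf] at hpair
  let l := (AddMonoidHom.toMultiplicative.symm ((entry₁₃ (ZMod p)).comp
    ((f.comp α).codRestrict _ fun v =>
      lowerCentral_two_le_two (hpair.left_mem v)))).toZModLinearMap p
  refine ⟨l, fun j i => ?_, fun v hv => ?_⟩
  · exact (congrArg e₁₃ (hpair.wedge j i)).trans (comm_e₁₃ _ _)
  · exact (lowerCentral_three_le_three (map_mem_lowerCentral f hv)).2.1

theorem exists_functional_phi (hp : p ≠ 2) (h : IsCommutatorPair u (gen p) α β)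
    {a b c : Fin n → ZMod p} (habc : ∀ i, a i * b i * c i = 0) :
    ∃ l : W (ZMod p) U →ₗ[ZMod p] ZMod p,
      (∀ j i k, l (phi (ZMod p) (u k) (wedge (ZMod p) (u j) (u i))) =
        (a j * b i - a i * b j) * c k - a k * (b j * c i - b i * c j)) ∧
      ∀ w, β (.ofAdd w) = 1 → l w = 0 := by
  obtain ⟨f, hf⟩ := exists_unitriangular_hom hp habc
  have hpair := h.map f
  rw [hf] at hpair
  let l := (AddMonoidHom.toMultiplicative.symm ((entry₁₄ (ZMod p)).comp
    ((f.comp β).codRestrict _ fun w =>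
      (lowerCentral_three_le_three (hpair.right_mem w)).1))).toZModLinearMap p
  have hl (w) : l w = (f (β (.ofAdd w))).e₁₄ := rfl
  refine ⟨l, fun j i k => ?_, fun w hw => ?_⟩
  · refine (congrArg e₁₄ (hpair.phi k _)).trans ?_
    rw [hpair.wedge, comm_eq_of_mem_two (comm_mem_two _ _), comm_e₁₃, comm_e₂₄]
    rfl
  · rw [hl, hw, map_one, one_def]

theorem eq_zero_of_mem_lowerCentral_three (hp : p ≠ 2) (h : IsCommutatorPair u (gen p) α β)
    {v : V (ZMod p) U} (hv : α (.ofAdd v) ∈ lowerCentral 3 (F p n)) : v = 0 := by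
  choose l hl hzero using fun s : {s : Fin n × Fin n // s.1 < s.2} =>
    exists_functional_wedge hp h (Pi.single s.1.2 1) (Pi.single s.1.1 1)
  refine eq_zero_of_dual_family (l := l)
    (b := fun s : {s : Fin n × Fin n // s.1 < s.2} => wedge (ZMod p) (u s.1.2) (u s.1.1))
    (eq_top_of_wedge_mem u fun i j hij => Submodule.subset_span ⟨⟨(i, j), hij⟩, rfl⟩)
    ?_ ?_ fun s => hzero s v hv
  · rintro ⟨⟨i, j⟩, hij⟩
    simp [hl, hij.ne]
  · rintro ⟨⟨i, j⟩, hij⟩ ⟨⟨i', j'⟩, hij'⟩ hne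
    rw [hl]
    simp only [Pi.single_apply, ne_eq, Subtype.mk.injEq, Prod.mk.injEq] at *
    split_ifs <;> grind

theorem ite_mul_ite_mul_ite {R : Type*} [MulZeroOneClass R] {P Q S : Prop} [Decidable P]
    [Decidable Q] [Decidable S] (h : ¬(P ∧ Q ∧ S)) :
    (if P then (1 : R) else 0) * (if Q then 1 else 0) * (if S then 1 else 0) = 0 := by
  split_ifs <;> simp_all

/-- Indices `(i, j, k)` with `i < j` and `i ≤ k` of the Hall basis `φ_k(u_j ∧ u_i)` of `W`. -/
abbrev HallTriple (n : ℕ) : Type :=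
  {s : Fin n × Fin n × Fin n // s.1 < s.2.1 ∧ s.1 ≤ s.2.2}

theorem right_injective (hp : p ≠ 2) (h : IsCommutatorPair u (gen p) α β) :
    Function.Injective β := by
  rw [injective_iff_map_eq_one]
  intro w hw
  choose l hl hzero using fun s : HallTriple n => exists_functional_phi hp h
    (a := Pi.single s.1.1 1) (b := Pi.single s.1.2.1 1) (c := Pi.single s.1.2.2 1) fun i => by
      simp only [Pi.single_apply]
      exact ite_mul_ite_mul_ite fun hi => s.2.1.ne (hi.1.symm.trans hi.2.1)
  refine eq_zero_of_dual_family (l := l)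
    (b := fun s : HallTriple n => phi (ZMod p) (u s.1.2.2) (wedge (ZMod p) (u s.1.2.1) (u s.1.1)))
    (eq_top_of_phi_wedge_mem u fun i j k hij hik =>
      Submodule.subset_span ⟨⟨(i, j, k), hij, hik⟩, rfl⟩)
    ?_ ?_ fun s => hzero s _ hw
  · rintro ⟨⟨i, j, k⟩, hij, hik⟩
    rw [hl]
    by_cases hik : i = k
    · subst hik
      simpa [hij.ne, ← neg_add', one_add_one_eq_two] using
        Ring.two_ne_zero (R := ZMod p) (by rwa [ZMod.ringChar_zmod_n])
    · simp [hij.ne, hik, Ne.symm hik]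
  · rintro ⟨⟨i, j, k⟩, hij, hik⟩ ⟨⟨i', j', k'⟩, hij', hik'⟩ hne
    rw [hl]
    simp only [Pi.single_apply, ne_eq, Subtype.mk.injEq, Prod.mk.injEq] at hij hik hij' hik' hne ⊢
    have h₁ := ite_mul_ite_mul_ite (R := ZMod p) (P := j' = i) (Q := i' = j) (S := k' = k)
      (by omega)
    have h₂ := ite_mul_ite_mul_ite (R := ZMod p) (P := i' = i) (Q := j' = j) (S := k' = k)
      (by omega)
    have h₃ := ite_mul_ite_mul_ite (R := ZMod p) (P := k' = i) (Q := j' = j) (S := i' = k)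
      (by omega)
    have h₄ := ite_mul_ite_mul_ite (R := ZMod p) (P := k' = i) (Q := i' = j) (S := j' = k)
      (by omega)
    linear_combination h₁ - h₂ - h₃ + h₄

variable (u) in
theorem exists_isCommutatorPair_gen (hp : p ≠ 2) : ∃ α β, IsCommutatorPair u (gen p) α β :=
  exists_isCommutatorPair u hp lowerCentral_four_F fun i j => by
    rw [gen_pow]; exact Commute.one_left _

theorem left_range_eq_C (h : IsCommutatorPair u (gen p) α β) : α.range = C p n := by
  refine le_antisymm ?_ ((Subgroup.closure_le _).2 ?_)
  · rintro _ ⟨v, rfl⟩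
    refine apply_mem_of_wedge_mem u (S := C p n) (fun i j hij => ?_) v
    rw [h.wedge]
    exact Subgroup.subset_closure ⟨i, j, hij, rfl⟩
  · rintro _ ⟨i, j, -, rfl⟩
    exact ⟨_, h.wedge j i⟩

theorem C_inf_lowerCentral_three (hp : p ≠ 2) : C p n ⊓ lowerCentral 3 (F p n) = ⊥ := by
  obtain ⟨α, β, h⟩ := exists_isCommutatorPair_gen (Pi.basisFun (ZMod p) (Fin n)) hp
  rw [← left_range_eq_C h, eq_bot_iff]
  rintro _ ⟨⟨v, rfl⟩, hv⟩
  have hzero : Multiplicative.toAdd v = 0 := eq_zero_of_mem_lowerCentral_three hp h hv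
  exact congrArg α (Multiplicative.toAdd.injective hzero) |>.trans (map_one α)

theorem C_sup_lowerCentral_three (hp : p ≠ 2) :
    C p n ⊔ lowerCentral 3 (F p n) = lowerCentral 2 (F p n) := by
  obtain ⟨α, β, h⟩ := exists_isCommutatorPair_gen (Pi.basisFun (ZMod p) (Fin n)) hp
  rw [← left_range_eq_C h, h.sup_lowerCentral_three closure_range_gen]

end Functionals

section Decomposition

variable {p n : ℕ} [Fact p.Prime] {U : Type*} [AddCommGroup U] [Module (ZMod p) U]
  {u : Module.Basis (Fin n) (ZMod p) U} {α : Multiplicative (V (ZMod p) U) →* F p n}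
  {β : Multiplicative (W (ZMod p) U) →* F p n}

theorem exists_mul_eq_of_mem_lowerCentral_two (h : IsCommutatorPair u (gen p) α β) {f : F p n}
    (hf : f ∈ lowerCentral 2 (F p n)) : ∃ v w, α v * β w = f := by
  rw [← h.sup_lowerCentral_three closure_range_gen,
    ← h.right_range lowerCentral_four_F closure_range_gen] at hf
  have : β.range.Normal := normal_of_le_center (by
    rw [h.right_range lowerCentral_four_F closure_range_gen]
    exact lowerCentral_three_le_center lowerCentral_four_F)
  obtain ⟨_, ⟨v, rfl⟩, _, ⟨w, rfl⟩, rfl⟩ := Subgroup.mem_sup_of_normal_right.1 hf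
  exact ⟨v, w, rfl⟩

theorem exists_mulEquiv_lowerCentral_two (hp : p ≠ 2) (h : IsCommutatorPair u (gen p) α β) :
    ∃ e : Multiplicative (V (ZMod p) U × W (ZMod p) U) ≃* lowerCentral 2 (F p n),
      ∀ v w, (e (.ofAdd (v, w)) : F p n) = α (.ofAdd v) * β (.ofAdd w) := by
  have hβ (w) : β w ∈ lowerCentral 2 (F p n) := lowerCentral_three_le_two (h.right_mem w)
  let θ := ((α.noncommCoprod β fun v w =>
    commute_of_mem_two lowerCentral_four_F (h.left_mem v) (hβ w)).comp
      (MulEquiv.prodMultiplicative _ _).toMonoidHom).codRestrict (lowerCentral 2 (F p n))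
        fun s => mul_mem (h.left_mem _) (hβ _)
  have hθ (v w) : (θ (.ofAdd (v, w)) : F p n) = α (.ofAdd v) * β (.ofAdd w) := rfl
  refine ⟨MulEquiv.ofBijective θ ⟨(injective_iff_map_eq_one θ).2 ?_, ?_⟩, hθ⟩
  · rintro ⟨v, w⟩ hvw
    have hone : α (.ofAdd v) * β (.ofAdd w) = 1 := congrArg Subtype.val hvw
    obtain rfl : v = 0 := eq_zero_of_mem_lowerCentral_three hp h <| by
      rw [eq_inv_of_mul_eq_one_left hone]
      exact inv_mem (h.right_mem _)
    rw [ofAdd_zero, map_one, one_mul, ← map_one β] at hone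
    exact congrArg (fun w => Multiplicative.ofAdd ((0 : V (ZMod p) U), Multiplicative.toAdd w))
      (right_injective hp h hone)
  · rintro ⟨f, hf⟩
    obtain ⟨v, w, rfl⟩ := exists_mul_eq_of_mem_lowerCentral_two h hf
    exact ⟨.ofAdd (v.toAdd, w.toAdd), rfl⟩

theorem IsIdentification.coe_eq
    {e : Multiplicative (V (ZMod p) U × W (ZMod p) U) ≃* lowerCentral 2 (F p n)}
    (he : IsIdentification u e) (h : IsCommutatorPair u (gen p) α β) (v w) :
    (e (.ofAdd (v, w)) : F p n) = α (.ofAdd v) * β (.ofAdd w) := by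
  let ε := (lowerCentral 2 (F p n)).subtype.comp e.toMonoidHom
  have hα : ε.comp (AddMonoidHom.toMultiplicative (AddMonoidHom.inl _ _)) = α :=
    hom_ext_wedge u fun j i => (he.1 j i).trans (h.wedge j i).symm
  have hβ : ε.comp (AddMonoidHom.toMultiplicative (AddMonoidHom.inr _ _)) = β :=
    hom_ext_phi_wedge u fun j i k => (he.2 j i k).trans (by rw [h.phi, h.wedge])
  have hadd : Multiplicative.ofAdd (v, w) = .ofAdd (v, 0) * .ofAdd (0, w) := by
    rw [← ofAdd_add, Prod.mk_add_mk, add_zero, zero_add]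
  rw [hadd, map_mul, ← hα, ← hβ]
  rfl

variable (u) in
theorem existsUnique_isIdentification (hp : p ≠ 2) :
    ∃! e : Multiplicative (V (ZMod p) U × W (ZMod p) U) ≃* lowerCentral 2 (F p n),
      IsIdentification u e := by
  obtain ⟨α, β, h⟩ := exists_isCommutatorPair_gen u hp
  obtain ⟨e, he⟩ := exists_mulEquiv_lowerCentral_two hp h
  refine ⟨e, ⟨fun j i => ?_, fun j i k => ?_⟩, fun e' he' => ?_⟩
  · rw [he, ofAdd_zero, map_one, mul_one, h.wedge]
  · rw [he, ofAdd_zero, map_one, one_mul, h.phi, h.wedge]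
  · ext ⟨v, w⟩
    exact (he'.coe_eq h v w).trans (he v w).symm

theorem IsRelationSubgroup.eq_inf (hp : p ≠ 2) {N X : Subgroup (F p n)}
    (h : IsRelationSubgroup N X) : X = N ⊓ C p n := by
  rw [← h.sup_eq, sup_inf_eq_of_disjoint h.le_C (C_inf_lowerCentral_three hp)]

theorem existsUnique_isRelationSubgroup (hp : p ≠ 2) {N : Subgroup (F p n)}
    (h₃ : lowerCentral 3 (F p n) ≤ N) (h₂ : N ≤ lowerCentral 2 (F p n)) :
    ∃! X, IsRelationSubgroup N X := by
  refine ⟨N ⊓ C p n, ⟨inf_le_right, ?_, ?_⟩, fun X hX => hX.eq_inf hp⟩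
  · rw [inf_assoc, C_inf_lowerCentral_three hp, inf_bot_eq]
  · exact inf_sup_eq_of_le h₃ (h₂.trans (C_sup_lowerCentral_three hp).ge)

theorem toSubspace_eq (hp : p ≠ 2)
    {e : Multiplicative (V (ZMod p) U × W (ZMod p) U) ≃* lowerCentral 2 (F p n)}
    (he : IsIdentification u e) (h : IsCommutatorPair u (gen p) α β) {N X : Subgroup (F p n)}
    (hX : IsRelationSubgroup N X) : toSubspace e X = comapSubmodule p α N := by
  ext v
  change (e (.ofAdd (v, 0)) : F p n) ∈ X ↔ α (.ofAdd v) ∈ N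
  rw [he.coe_eq h, ofAdd_zero, map_one, mul_one, hX.eq_inf hp, Subgroup.mem_inf,
    ← left_range_eq_C h]
  exact and_iff_left ⟨_, rfl⟩

end Decomposition

section ZMod

variable {p n : ℕ} {K ι A : Type*} [Group K] [AddCommGroup A] [Module (ZMod p) A]

theorem closure_range_ofAdd_basis (b : Module.Basis ι (ZMod p) A) :
    Subgroup.closure (Set.range fun i => Multiplicative.ofAdd (b i)) = ⊤ := by
  set S := Subgroup.closure (Set.range fun i => Multiplicative.ofAdd (b i))
  have hmem (i) : Multiplicative.ofAdd (b i) ∈ S := Subgroup.subset_closure ⟨i, rfl⟩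
  have htop : comapSubmodule p (MonoidHom.id (Multiplicative A)) S = ⊤ :=
    eq_top_of_basis_mem b hmem
  exact eq_top_iff.2 fun a _ => htop.ge (Submodule.mem_top (x := Multiplicative.toAdd a))

/-- Sending the basis back to the generators recovers `Abelianization.of` from `q`. -/
theorem ker_le_lowerCentral_two_of_basis {x : ι → K} (hx : Subgroup.closure (Set.range x) = ⊤)
    (hxp : ∀ i, x i ^ p = 1) (b : Module.Basis ι (ZMod p) A) {q : K →* Multiplicative A}
    (hq : ∀ i, q (x i) = .ofAdd (b i)) : q.ker ≤ lowerCentral 2 K := by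
  have hpow : (powMonoidHom p).comp (Abelianization.of (G := K)) = 1 :=
    MonoidHom.eq_of_eqOn_dense hx <| by
      rintro _ ⟨i, rfl⟩
      exact (map_pow Abelianization.of (x i) p).symm.trans (by rw [hxp, map_one]; rfl)
  let _ : Module (ZMod p) (Additive (Abelianization K)) :=
    AddCommGroup.zmodModule (n := p) fun a => by
      obtain ⟨y, hy⟩ := QuotientGroup.mk_surjective (Additive.toMul a)
      exact Additive.toMul.injective
        ((congrArg (· ^ p) hy.symm).trans (DFunLike.congr_fun hpow y))
  let σ := b.constr (ZMod p) fun i => Additive.ofMul (Abelianization.of (x i))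
  have hσ : (AddMonoidHom.toMultiplicativeLeft σ.toAddMonoidHom).comp q = Abelianization.of :=
    MonoidHom.eq_of_eqOn_dense hx <| by
      rintro _ ⟨i, rfl⟩
      rw [MonoidHom.comp_apply, hq]
      exact congrArg Additive.toMul (b.constr_basis (ZMod p) _ i)
  intro f hf
  have hof : Abelianization.of f = 1 := by
    rw [← hσ, MonoidHom.comp_apply, MonoidHom.mem_ker.1 hf, map_one]
  exact (QuotientGroup.eq_one_iff f).1 hof

end ZMod

section Centralizer

open Unitriangular

variable {p n : ℕ} [Fact p.Prime]

theorem mem_lowerCentral_two_of_comm_gen_mem [Nontrivial (Fin n)] (hp : p ≠ 2) {f : F p n}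
    (hf : ∀ k, comm f (gen p k) ∈ lowerCentral 3 (F p n)) : f ∈ lowerCentral 2 (F p n) := by
  choose m hm using fun i : Fin n => exists_ne i
  choose ρ hρ using fun i => exists_unitriangular_hom hp (n := n) (a := Pi.single i 1)
    (b := Pi.single (m i) 1) (c := 0) fun j => mul_zero _
  let q : F p n →* Multiplicative (Fin n → ZMod p) :=
    { toFun := fun f => .ofAdd fun i => (ρ i f).e₁₂
      map_one' := by simp only [map_one]; rfl
      map_mul' := fun f g => by simp only [map_mul]; rfl }
  refine ker_le_lowerCentral_two_of_basis closure_range_gen gen_pow (Pi.basisFun (ZMod p) (Fin n))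
    (q := q) (fun k => ?_) ?_
  · refine congrArg Multiplicative.ofAdd (funext fun i => ?_)
    rw [Pi.basisFun_apply, Pi.single_comm]
    exact congrArg e₁₂ (congrFun (hρ i) k)
  · refine congrArg Multiplicative.ofAdd (funext fun i => ?_)
    have hgen : ρ i (gen p (m i)) = _ := congrFun (hρ i) (m i)
    have hcomm := (lowerCentral_three_le_three (map_mem_lowerCentral (ρ i) (hf (m i)))).2.1
    rw [map_comm, comm_e₁₃, hgen] at hcomm
    simpa [ofSuperdiagonal, hm i] using hcomm

end Centralizer

section Presentation

variable {p n : ℕ} {G : Type*} [Group G] (hclass : lowerCentral 3 G = ⊥)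
  (hexp : Monoid.exponent G = p) {g : Fin n → G}

theorem psi_comp_gen : psi hclass hexp g ∘ gen p = g :=
  funext (psi_gen hclass hexp g)

theorem lowerCentral_three_le_ker_psi : lowerCentral 3 (F p n) ≤ (psi hclass hexp g).ker :=
  fun _ hf => (Subgroup.mem_bot).1 (hclass ▸ map_mem_lowerCentral (psi hclass hexp g) hf)

variable (hg : ProjectsToBasis hexp g)

include hg in
theorem ker_psi_le : (psi hclass hexp g).ker ≤ lowerCentral 2 (F p n) := by
  let _ := abelianizationModule hexp
  obtain ⟨b, hb⟩ := hg
  intro f hf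
  refine ker_le_lowerCentral_two_of_basis closure_range_gen gen_pow b (q :=
    (MulEquiv.multiplicativeAdditive (Abelianization G)).symm.toMonoidHom.comp
      (Abelianization.of.comp (psi hclass hexp g))) (fun i => ?_) ?_
  · rw [hb, MonoidHom.comp_apply, MonoidHom.comp_apply, psi_gen]
    rfl
  · rw [MonoidHom.mem_ker, MonoidHom.comp_apply, MonoidHom.comp_apply, hf, map_one, map_one]

include hclass hg in
theorem closure_range_eq_top_of_projectsToBasis : Subgroup.closure (Set.range g) = ⊤ := by
  let _ := abelianizationModule hexp
  obtain ⟨b, hb⟩ := hg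
  refine closure_range_eq_top_of_abelianization
    (Subgroup.commutator_top_right_eq_bot_iff_le_center.1 hclass) ?_
  have hspan := closure_range_ofAdd_basis b
  simp only [hb] at hspan
  exact hspan

include hg in
theorem psi_surjective : Function.Surjective (psi hclass hexp g) := by
  rw [← MonoidHom.range_eq_top, eq_top_iff,
    ← closure_range_eq_top_of_projectsToBasis hclass hexp hg, Subgroup.closure_le]
  rintro _ ⟨i, rfl⟩
  exact ⟨gen p i, psi_gen hclass hexp g i⟩

end Presentation

theorem nontrivial_of_not_isCyclic {G ι : Type*} [Group G] {g : ι → G} (hG : ¬ IsCyclic G)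
    (hg : Subgroup.closure (Set.range g) = ⊤) : Nontrivial ι := by
  by_contra hι
  have := not_nontrivial_iff_subsingleton.1 hι
  rw [isCyclic_iff_exists_zpowers_eq_top] at hG
  obtain h | ⟨y, hy⟩ := (Set.subsingleton_range g).eq_empty_or_singleton
  · exact hG ⟨1, by rw [Subgroup.zpowers_one_eq_bot, ← hg, h, Subgroup.closure_empty]⟩
  · exact hG ⟨y, by rw [Subgroup.zpowers_eq_closure, ← hy, hg]⟩

section Capability

variable {p n : ℕ} [Fact p.Prime] {U : Type*} [AddCommGroup U] [Module (ZMod p) U]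

theorem IsCommutatorPair.comapSubmodule_center {K ι : Type*} [Group K] {x : ι → K}
    {u : Module.Basis ι (ZMod p) U} {α : Multiplicative (V (ZMod p) U) →* K}
    {β : Multiplicative (W (ZMod p) U) →* K} (h : IsCommutatorPair u x α β)
    (hx : Subgroup.closure (Set.range x) ⊔ Subgroup.center K = ⊤) :
    comapSubmodule p α (Subgroup.center K) =
      downStar (CapableGroups.phi (ZMod p) : U → _) (comapSubmodule p β ⊥) := by
  ext v
  rw [mem_downStar_phi_iff u]
  refine (mem_center_iff_of_closure_sup_center hx).trans (forall_congr' fun k => ?_)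
  exact (Eq.congr_left (h.phi k v)).symm

variable {u : Module.Basis (Fin n) (ZMod p) U} {α : Multiplicative (V (ZMod p) U) →* F p n}
  {β : Multiplicative (W (ZMod p) U) →* F p n}

/-- In other words, `N / β(Y)` is the centre of `F / β(Y)`. -/
theorem forall_comm_gen_mem_map_iff [Nontrivial (Fin n)] (hp : p ≠ 2)
    (h : IsCommutatorPair u (gen p) α β) (Y : Submodule (ZMod p) (W (ZMod p) U))
    {N : Subgroup (F p n)} (h₃ : lowerCentral 3 (F p n) ≤ N) (h₂ : N ≤ lowerCentral 2 (F p n))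
    (hN : comapSubmodule p α N = downStar (phi (ZMod p) : U → _) Y) {f : F p n} :
    (∀ k, comm f (gen p k) ∈ Y.toAddSubgroup.toSubgroup.map β) ↔ f ∈ N := by
  have hY (w) : β (.ofAdd w) ∈ Y.toAddSubgroup.toSubgroup.map β ↔ w ∈ Y :=
    Subgroup.mem_map_iff_mem (right_injective hp h)
  have hmul (v w) :
      (∀ k, comm (α v * β w) (gen p k) ∈ Y.toAddSubgroup.toSubgroup.map β) ↔ α v * β w ∈ N := by
    rw [Subgroup.mul_mem_cancel_right N (h₃ (h.right_mem w))]
    have hv : α v ∈ N ↔ v.toAdd ∈ comapSubmodule p α N := Iff.rfl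
    rw [hv, hN, mem_downStar_phi_iff u]
    exact forall_congr' fun k => by
      rw [← hY, ← h.comm_mul lowerCentral_four_F v.toAdd w k]
      rfl
  constructor
  · intro hf
    have hf₂ : f ∈ lowerCentral 2 (F p n) := mem_lowerCentral_two_of_comm_gen_mem hp fun k => by
      obtain ⟨w, -, hw⟩ := hf k
      exact hw ▸ h.right_mem w
    obtain ⟨v, w, rfl⟩ := exists_mul_eq_of_mem_lowerCentral_two h hf₂
    exact (hmul v w).1 hf
  · intro hf
    obtain ⟨v, w, rfl⟩ := exists_mul_eq_of_mem_lowerCentral_two h (h₂ hf)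
    exact (hmul v w).2 hf

variable {G : Type*} [Group G] {hclass : lowerCentral 3 G = ⊥} {hexp : Monoid.exponent G = p}
  {g : Fin n → G} (hg : ProjectsToBasis hexp g) (h : IsCommutatorPair u (gen p) α β)

include hg h in
theorem isClosedFor_of_isCapable (hp : p ≠ 2) (hG : IsCapable G) :
    IsClosedFor (phi (ZMod p) : U → _) (comapSubmodule p α (psi hclass hexp g).ker) := by
  obtain ⟨H, _, q, hq, hker⟩ := hG.exists_surjective
  have hH : lowerCentral 4 H = ⊥ := by
    refine Subgroup.commutator_top_right_eq_bot_iff_le_center.2 fun y hy => ?_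
    rw [← hker, MonoidHom.mem_ker, ← Subgroup.mem_bot, ← hclass]
    exact map_mem_lowerCentral q hy
  choose y hy using fun i => hq (g i)
  have hqy : q ∘ y = g := funext hy
  have hypow (i) : y i ^ p ∈ Subgroup.center H := by
    rw [← hker, MonoidHom.mem_ker, map_pow, ← hexp, Monoid.pow_exponent_eq_one]
  obtain ⟨α', β', h'⟩ := exists_isCommutatorPair u (x := y) hp hH fun i j =>
    (Subgroup.mem_center_iff.1 (hypow i) (y j)).symm
  have hα : q.comp α' = (psi hclass hexp g).comp α :=
    (hqy ▸ h'.map q).left_unique (psi_comp_gen hclass hexp ▸ h.map (psi hclass hexp g))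
  have hX :
      comapSubmodule p α (psi hclass hexp g).ker = comapSubmodule p α' (Subgroup.center H) := by
    ext v
    rw [← hker]
    exact Eq.congr_left (DFunLike.congr_fun hα (.ofAdd v)).symm
  have hgen : Subgroup.closure (Set.range y) ⊔ Subgroup.center H = ⊤ := by
    rw [← hker]
    exact closure_range_sup_ker_eq_top
      (hqy ▸ closure_range_eq_top_of_projectsToBasis hclass hexp hg)
  rw [hX, h'.comapSubmodule_center hgen]
  exact isClosedFor_downStar _ _

include hg h in
theorem isCapable_of_isClosedFor (hp : p ≠ 2) (hcyc : ¬ IsCyclic G)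
    (hX : IsClosedFor (phi (ZMod p) : U → _) (comapSubmodule p α (psi hclass hexp g).ker)) :
    IsCapable G := by
  set ψ := psi hclass hexp g
  have h₃ : lowerCentral 3 (F p n) ≤ ψ.ker := lowerCentral_three_le_ker_psi hclass hexp
  have := nontrivial_of_not_isCyclic hcyc (closure_range_eq_top_of_projectsToBasis hclass hexp hg)
  let Y := upStar (phi (ZMod p) : U → _) (comapSubmodule p α ψ.ker)
  let N : Subgroup (F p n) := Y.toAddSubgroup.toSubgroup.map β
  have hN : N ≤ lowerCentral 3 (F p n) := by
    rintro _ ⟨w, -, rfl⟩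
    exact h.right_mem w
  have : N.Normal :=
    normal_of_le_center (hN.trans (lowerCentral_three_le_center lowerCentral_four_F))
  refine isCapable_of_ker_eq_center (f := QuotientGroup.lift N ψ (hN.trans h₃))
    (QuotientGroup.lift_surjective_of_surjective _ _ (psi_surjective hclass hexp hg) _) ?_
  ext f
  obtain ⟨f, rfl⟩ := QuotientGroup.mk_surjective f
  exact (forall_comm_gen_mem_map_iff hp h Y h₃ (ker_psi_le hclass hexp hg) hX).symm.trans
    (mk_mem_center_iff closure_range_gen).symm

end Capability

end CapableGroups

open CapableGroups in
theorem mainTheorem1 {p : ℕ} [Fact p.Prime] (hp : p ≠ 2) {n : ℕ}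
    {U : Type*} [AddCommGroup U] [Module (ZMod p) U] (u : Module.Basis (Fin n) (ZMod p) U)
    {G : Type*} [Group G] (hcyc : ¬ IsCyclic G) (hclass : lowerCentral 3 G = ⊥)
    (hexp : Monoid.exponent G = p) (g : Fin n → G) (hg : ProjectsToBasis hexp g) :
    (∃! e, IsIdentification u e) ∧
    (∃! X, IsRelationSubgroup (psi hclass hexp g).ker X) ∧
    ∀ e X, IsIdentification u e → IsRelationSubgroup (psi hclass hexp g).ker X →
      (IsCapable G ↔ IsClosedFor (phi (ZMod p) : U → _) (toSubspace e X)) := by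
  refine ⟨existsUnique_isIdentification u hp, existsUnique_isRelationSubgroup hp
    (lowerCentral_three_le_ker_psi hclass hexp) (ker_psi_le hclass hexp hg), fun e X he hX => ?_⟩
  obtain ⟨α, β, h⟩ := exists_isCommutatorPair_gen u hp
  rw [toSubspace_eq hp he h hX]
  exact ⟨isClosedFor_of_isCapable hg h hp, isCapable_of_isClosedFor hg h hp hcyc⟩
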